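/- Write $\mathbb H^{\pm}=\{z\in\mathbb C:\pm\operatorname{Im} z>0\}$. For an entire function $h$ there are unique real entire functions $p,q$ (entire functions that are real valued on $\mathbb R$) with $h=p-\mathrm i q$. Let $\mathcal M$ be the class of entire functions $f$ such that (1) $f(z)=C\prod_{n\ge1}(1-z/z_n)$ with $C\neq0$ and $z_n\in\mathbb H^+$ for all $n\ge 1$; (2) for every $n\ge0$, $z^n/f(z)\to0$ as $z\to\infty$, uniformly in $\mathbb H^-\cup\mathbb R$. A Pick function is an analytic function $\phi:\mathbb H^+\to\mathbb H^+$. Let $\mathcal P_b$ be the class of Pick functions $\phi$ such that (1) the limit $\phi(x):=\lim_{\epsilon\to0^+}\phi(x+\mathrm i\epsilon)$ exists uniformly in $x$ on compact subsets of $\mathbb R$; (2) the closure of $\phi(\mathbb H^+)$ is a bounded subset of $\mathbb H^+$. For $f\in\mathcal M$, written $f=b-\mathrm i d$ with $b,d$ real entire, and $\phi\in\mathcal P_b$, put $$\mu(x;\phi)=\frac{\operatorname{Im}(\phi(x))/\pi}{|d(x)-\phi(x)b(x)|^2},\qquad x\in\mathbb R.$$ **Theorem.** Fix $f=b-\mathrm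 i d\in\mathcal M$ and define (with $\phi\equiv \mathrm i$) $$g(z)=-f(z)\int_{\mathbb R}\frac{\mu(x;\mathrm i)\,dx}{x-z},\qquad z\in\mathbb H^-,$$ the integral being absolutely convergent. Then: (i) $g$ can be analytically continued to an entire function. (ii) Let $g=a-\mathrm i c$ with $a,c$ real entire. Then $a(z)d(z)-b(z)c(z)=1$ for all $z\in\mathbb C$. (iii) For all $\phi\in\mathcal P_b$ and all $z\in\mathbb H^+$, the integral below converges absolutely, $b(z)\phi(z)-d(z)\neq0$, and $$\int_{\mathbb R}\frac{\mu(x;\phi)\,dx}{x-z}=-\frac{a(z)\phi(z)-c(z)}{b(z)\phi(z)-d(z)}.$$ -/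

import Mathlib

open Complex Filter Topology MeasureTheory

noncomputable section

namespace NevanlinnaType

/-- The open upper half-plane, as a subset of `ℂ`. -/
def upperPlane : Set ℂ := {z | 0 < z.im}

/-- The open lower half-plane, as a subset of `ℂ`. -/
def lowerPlane : Set ℂ := {z | z.im < 0}

/-- The reflection of `f` in the real line: the function whose value at `z` is the conjugate of
`f` at the conjugate of `z`. -/
def reflect (f : ℂ → ℂ) (z : ℂ) : ℂ := (starRingEnd ℂ) (f ((starRingEnd ℂ) z))

/-- A real entire function: entire, and real valued on the real line. -/
def IsRealEntire (h : ℂ → ℂ) : Prop :=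
  Differentiable ℂ h ∧ ∀ x : ℝ, (h (x : ℂ)).im = 0

/-- The real entire function `p` in the decomposition `h = p - i q` of an entire function `h`
(see `isRealEntire_compRe`, `decomposition`, `decomposition_unique`). -/
def compRe (h : ℂ → ℂ) (z : ℂ) : ℂ := (h z + reflect h z) / 2

/-- The real entire function `q` in the decomposition `h = p - i q` of an entire function `h`
(see `isRealEntire_compIm`, `decomposition`, `decomposition_unique`). -/
def compIm (h : ℂ → ℂ) (z : ℂ) : ℂ := I * (h z - reflect h z) / 2

/-- The class `𝓜`: entire functions `f` with `f(w) = C ∏_{n ≥ 1} (1 - w / z_n)`, `C ≠ 0`, all `z_n`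
in the open upper half-plane (the product is the limit of its partial products in the given order),
such that for every `n` one has `w ^ n / f w → 0` as `w → ∞`, uniformly in the closed lower
half-plane. -/
structure ClassM (f : ℂ → ℂ) : Prop where
  entire : Differentiable ℂ f
  product : ∃ (C : ℂ) (z : ℕ → ℂ), C ≠ 0 ∧ (∀ n, z n ∈ upperPlane) ∧
    ∀ w : ℂ, Tendsto (fun N : ℕ => C * ∏ n ∈ Finset.range N, (1 - w / z n)) atTop (𝓝 (f w))
  decay : ∀ n : ℕ, Tendsto (fun w : ℂ => w ^ n / f w)
    (Bornology.cobounded ℂ ⊓ 𝓟 {w : ℂ | w.im ≤ 0}) (𝓝 0)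

/-- The boundary value `φ(x) = lim_{ε → 0+} φ(x + i ε)` at a real point `x`. -/
def boundaryValue (φ : ℂ → ℂ) (x : ℝ) : ℂ :=
  limUnder (𝓝[>] (0 : ℝ)) (fun ε : ℝ => φ ((x : ℂ) + I * (ε : ℂ)))

/-- A Pick function: analytic in the open upper half-plane, which it maps to itself. Only the values
of `φ` in the open upper half-plane matter. -/
structure IsPick (φ : ℂ → ℂ) : Prop where
  analytic : DifferentiableOn ℂ φ upperPlane
  mapsTo : Set.MapsTo φ upperPlane upperPlane

/-- The class `𝓟_b` of Pick functions `φ` such that `φ(x + i ε)` converges as `ε → 0+`, uniformly in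
`x` on compact subsets of `ℝ`, and such that the closure of the image of the upper half-plane is a
bounded subset of the open upper half-plane. -/
structure ClassPb (φ : ℂ → ℂ) : Prop where
  pick : IsPick φ
  boundary : ∀ K : Set ℝ, IsCompact K →
    TendstoUniformlyOn (fun (ε : ℝ) (x : ℝ) => φ ((x : ℂ) + I * (ε : ℂ))) (boundaryValue φ)
      (𝓝[>] (0 : ℝ)) K
  bounded : Bornology.IsBounded (closure (φ '' upperPlane))
  closure_subset : closure (φ '' upperPlane) ⊆ upperPlane

/-- The density `μ(x; φ, f) = (Im φ(x) / π) / |d(x) - φ(x) b(x)|²`, where `f = b - i d` with real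
entire `b`, `d`. -/
def mu (φ f : ℂ → ℂ) (x : ℝ) : ℝ :=
  ((boundaryValue φ x).im / Real.pi) /
    ‖compIm f (x : ℂ) - boundaryValue φ x * compRe f (x : ℂ)‖ ^ 2

/-- The Stieltjes transform `∫ μ(x; φ, f) dx / (x - z)`. -/
def stieltjes (φ f : ℂ → ℂ) (z : ℂ) : ℂ :=
  ∫ x : ℝ, (mu φ f x : ℂ) / ((x : ℂ) - z)

/-- The function `g(z) = - f(z) ∫ μ(x; i, f) dx / (x - z)`, to be used for `z` in the lower
half-plane. -/
def gLower (f : ℂ → ℂ) (z : ℂ) : ℂ :=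
  - f z * stieltjes (fun _ => I) f z

theorem differentiable_reflect {h : ℂ → ℂ} (hh : Differentiable ℂ h) :
    Differentiable ℂ (reflect h) := by
  intro z
  exact (differentiableAt_conj_conj_iff (f := h) (x := z)).2 (hh _)

theorem isRealEntire_compRe {h : ℂ → ℂ} (hh : Differentiable ℂ h) : IsRealEntire (compRe h) := by
  refine ⟨(hh.add (differentiable_reflect hh)).div_const 2, fun x => ?_⟩
  simp [compRe, reflect]

theorem isRealEntire_compIm {h : ℂ → ℂ} (hh : Differentiable ℂ h) : IsRealEntire (compIm h) := by
  refine ⟨((hh.sub (differentiable_reflect hh)).const_mul I).div_const 2, fun x => ?_⟩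
  simp [compIm, reflect]

theorem decomposition (h : ℂ → ℂ) (z : ℂ) : h z = compRe h z - I * compIm h z := by
  simp only [compRe, compIm]
  linear_combination ((h z - reflect h z) / 2) * I_sq

theorem reflect_eq_self {p : ℂ → ℂ} (hp : IsRealEntire p) : reflect p = p := by
  have h1 : AnalyticOnNhd ℂ p Set.univ := fun z _ => hp.1.analyticAt z
  have h2 : AnalyticOnNhd ℂ (reflect p) Set.univ :=
    fun z _ => (differentiable_reflect hp.1).analyticAt z
  refine h2.eq_of_frequently_eq h1 (z₀ := 0) ?_
  have ht : Tendsto (fun n : ℕ => (((1 / ((n : ℝ) + 1) : ℝ)) : ℂ)) atTop (𝓝[≠] (0 : ℂ)) := by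
    refine tendsto_nhdsWithin_iff.2 ⟨?_, Eventually.of_forall fun n => ?_⟩
    · have := (continuous_ofReal.tendsto 0).comp
        (tendsto_one_div_add_atTop_nhds_zero_nat (𝕜 := ℝ))
      simpa [Function.comp_def] using this
    · have : (0 : ℝ) < 1 / ((n : ℝ) + 1) := by positivity
      simpa only [Set.mem_compl_iff, Set.mem_singleton_iff, ofReal_eq_zero] using this.ne'
  refine ht.frequently (Frequently.of_forall fun n => ?_)
  rw [reflect, conj_ofReal]
  exact conj_eq_iff_im.2 (hp.2 _)

theorem decomposition_unique {h p q : ℂ → ℂ} (hp : IsRealEntire p) (hq : IsRealEntire q)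
    (hpq : ∀ z, h z = p z - I * q z) : p = compRe h ∧ q = compIm h := by
  have hr : ∀ z, reflect h z = p z + I * q z := by
    intro z
    have h1 := congrFun (reflect_eq_self hp) z
    have h2 := congrFun (reflect_eq_self hq) z
    simp only [reflect] at h1 h2 ⊢
    rw [hpq, map_sub, map_mul, conj_I, h1, h2]
    ring
  refine ⟨funext fun z => ?_, funext fun z => ?_⟩
  · rw [compRe, hr, hpq]
    ring
  · rw [compIm, hr, hpq]
    linear_combination q z * I_sq

end NevanlinnaType

end

/-! Write `f#` for `reflect f` and `S` for the Stieltjes transform of `mu` at the parameter `I`. On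
the real line this density is `1 / (π f f#)`. The product makes `|f| ≤ |f#|` on the upper
half-plane, and `f#` has no zeros on its closure; by the decay condition `1 / f#` is `O((1 +
|w|²)⁻¹)` there.

Continuation: put `g(z) = ∫ (f(x) - f(z)) / (x - z) · mu(x) dx`. The difference quotient is entire
in `z`, so `g` is entire. For nonreal `z` the integral splits into the Cauchy integral of `1 / (π
f#)` minus `f(z) S(z)`. That Cauchy integral is `0` below the line and `2i / f#(z)` above it. Hence
`g = -f S` below and `g = 2i / f# - f S` above. Since `S` commutes with conjugation, `g# = -f# S`
above. Eliminating `S` gives `f# g - f g# = 2i` on the upper half-plane, hence everywhere, and this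
is `ad - bc = 1`.

General parameter: let `θ = (φ - i) / (φ + i)`, so that `|θ| ≤ δ < 1`. Then `bφ - d` and `aφ - c`
are `(φ + i) / 2` times `fθ + f#` and `gθ + g#`, and the formulas for `g` and `g#` turn the claimed
right side into `S + E` with `E = -2iθ / (f# (fθ + f#))`. On the line, the two densities differ by
`(E - conj E) / (2πi)` (`ClassM.mu_eq_add`). Since `E` is analytic and decays above, the Cauchy
formula turns the `E` term into `E(z)` and kills the conjugate term (`ClassM.stieltjes_eq_add`). -/

noncomputable section

namespace NevanlinnaType

/-! ### Cauchy theorem and formula for the upper half-plane -/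

/-- A function holomorphic on the closed upper half-plane and quadratically small at infinity is
integrable on the real line, with integral zero. -/
theorem integral_real_eq_zero {H : ℂ → ℂ} {C R₀ : ℝ}
    (hd : DifferentiableOn ℂ H {w | 0 ≤ w.im}) (hR : 1 ≤ R₀)
    (hb : ∀ w : ℂ, 0 ≤ w.im → R₀ ≤ ‖w‖ → ‖H w‖ ≤ C / ‖w‖ ^ 2) :
    Integrable (fun x : ℝ => H x) ∧ ∫ x : ℝ, H x = 0 := by
  have hcont : Continuous fun x : ℝ => H x :=
    hd.continuousOn.comp_continuous continuous_ofReal (fun x => by simp)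
  have hC : 0 ≤ C := by
    have h1 := (norm_nonneg _).trans (hb (R₀ : ℂ) (by simp) (by simp [abs_of_nonneg (zero_le_one.trans hR)]))
    have h2 : 0 < ‖(R₀ : ℂ)‖ ^ 2 := by
      have : (R₀ : ℂ) ≠ 0 := by exact_mod_cast (by linarith : R₀ ≠ 0)
      positivity
    by_contra hc
    exact absurd h1 (not_le.2 (div_neg_of_neg_of_pos (not_le.1 hc) h2))
  have hint : Integrable (fun x : ℝ => H x) := by
    refine hcont.locallyIntegrable.integrable_of_isBigO_cocompact (g := fun x : ℝ => (1 + x ^ 2)⁻¹)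
      ?_ (integrable_inv_one_add_sq.integrableAtFilter _)
    refine Asymptotics.IsBigO.of_bound (2 * C) ?_
    have := (tendsto_norm_cocompact_atTop (E := ℝ)).eventually_ge_atTop R₀
    filter_upwards [this] with x hx
    refine (hb x (by simp) (by simpa using hx)).trans ?_
    have h1 : (1 : ℝ) ≤ |x| := hR.trans (by simpa using hx)
    have h2 : 1 ≤ x ^ 2 := by rw [← sq_abs]; nlinarith
    rw [norm_real, Real.norm_eq_abs, sq_abs, Real.norm_eq_abs, abs_of_pos (by positivity), mul_comm 2,
      mul_assoc, div_eq_mul_inv]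
    refine mul_le_mul_of_nonneg_left ?_ hC
    rw [← div_eq_mul_inv, inv_le_comm₀ (by positivity) (by positivity), inv_div]
    linarith
  refine ⟨hint, ?_⟩
  have hlim := intervalIntegral_tendsto_integral hint tendsto_neg_atTop_atBot tendsto_id
  -- Integrate around the rectangle over `[-R, R]` of height `R`: the other three sides have total
  -- length `4R`, and `H` is at most `C / R²` there.
  refine tendsto_nhds_unique hlim (squeeze_zero_norm' (a := fun R : ℝ => 4 * C / R) ?_ ?_)
  · filter_upwards [eventually_ge_atTop R₀] with R hR'
    have hRpos : 0 < R := by linarith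
    have key := integral_boundary_rect_eq_zero_of_differentiableOn H (-R : ℂ) (R + R * I)
      (hd.mono fun w hw => by
        have := hw.2
        simp only [neg_im, ofReal_im, neg_zero, add_im, mul_im, ofReal_re, I_im, mul_one, I_re,
          mul_zero, add_zero, zero_add, Set.mem_preimage, Set.uIcc_of_le hRpos.le] at this
        exact this.1)
    simp only [neg_re, ofReal_re, neg_im, ofReal_im, add_re, mul_re, I_re, mul_zero, I_im, mul_one,
      sub_self, add_zero, add_im, mul_im, zero_add, neg_zero, ofReal_zero, zero_mul] at key
    have hside : ∀ w : ℂ, 0 ≤ w.im → R ≤ ‖w‖ → ‖H w‖ ≤ C / R ^ 2 := fun w h1 h2 =>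
      (hb w h1 (hR'.trans h2)).trans (div_le_div_of_nonneg_left hC (by positivity) (by gcongr))
    have e1 : ‖∫ x : ℝ in (-R)..R, H (x + R * I)‖ ≤ C / R ^ 2 * |R - -R| := by
      refine intervalIntegral.norm_integral_le_of_norm_le_const fun x _ => hside _ ?_ ?_
      · simpa using hRpos.le
      · refine le_trans ?_ (abs_im_le_norm _)
        simp [abs_of_pos hRpos]
    have e2 : ‖∫ y : ℝ in (0 : ℝ)..R, H (R + y * I)‖ ≤ C / R ^ 2 * |R - 0| := by
      refine intervalIntegral.norm_integral_le_of_norm_le_const fun y hy => hside _ ?_ ?_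
      · rw [Set.uIoc_of_le hRpos.le] at hy
        simpa using hy.1.le
      · refine le_trans ?_ (abs_re_le_norm _)
        simp [abs_of_pos hRpos]
    have e3 : ‖∫ y : ℝ in (0 : ℝ)..R, H (((-R : ℝ) : ℂ) + y * I)‖ ≤ C / R ^ 2 * |R - 0| := by
      refine intervalIntegral.norm_integral_le_of_norm_le_const fun y hy => hside _ ?_ ?_
      · rw [Set.uIoc_of_le hRpos.le] at hy
        simpa using hy.1.le
      · refine le_trans ?_ (abs_re_le_norm _)
        simp [abs_of_pos hRpos]
    have e4 : (∫ x : ℝ in (-R)..R, H x) = (∫ x : ℝ in (-R)..R, H (x + R * I))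
        - I • (∫ y : ℝ in (0 : ℝ)..R, H (R + y * I))
        + I • (∫ y : ℝ in (0 : ℝ)..R, H (((-R : ℝ) : ℂ) + y * I)) := by
      linear_combination key
    simp only [id]
    rw [e4]
    refine (norm_add_le _ _).trans ((add_le_add_left (norm_sub_le _ _) _).trans ?_)
    rw [norm_smul, norm_smul, norm_I, one_mul, one_mul]
    have e5 : |R - -R| = 2 * R := by rw [abs_of_pos] <;> linarith
    have e6 : |R - 0| = R := by rw [sub_zero, abs_of_pos hRpos]
    rw [e5] at e1
    rw [e6] at e2 e3
    calc _ ≤ C / R ^ 2 * (2 * R) + C / R ^ 2 * R + C / R ^ 2 * R := by gcongr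
      _ = 4 * C / R := by field_simp; ring
  · exact tendsto_const_nhds.div_atTop tendsto_id

theorem abs_im_le_norm_ofReal_sub (x : ℝ) (z : ℂ) : |z.im| ≤ ‖(x : ℂ) - z‖ := by
  simpa using abs_im_le_norm ((x : ℂ) - z)

theorem ofReal_sub_ne_zero {z : ℂ} (hz : z.im ≠ 0) (x : ℝ) : (x : ℂ) - z ≠ 0 := by
  intro h
  have := congrArg im h
  simp at this
  exact hz this

/-- The total mass of the Poisson kernel. -/
theorem integral_poisson {z : ℂ} (hz : 0 < z.im) :
    ∫ x : ℝ, (z - (starRingEnd ℂ) z) / (((x : ℂ) - z) * ((x : ℂ) - (starRingEnd ℂ) z))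
      = 2 * Real.pi * I := by
  have h1 : (∫ x : ℝ, z.im⁻¹ * (1 + ((x - z.re) / z.im) ^ 2)⁻¹) = Real.pi := by
    rw [integral_const_mul,
      integral_sub_right_eq_self (fun x : ℝ => (1 + (x / z.im) ^ 2)⁻¹) z.re,
      Measure.integral_comp_div (fun x : ℝ => (1 + x ^ 2)⁻¹), integral_univ_inv_one_add_sq,
      abs_of_pos hz, smul_eq_mul]
    field_simp
  have h2 : ∀ x : ℝ, (z - (starRingEnd ℂ) z) / (((x : ℂ) - z) * ((x : ℂ) - (starRingEnd ℂ) z))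
      = 2 * I * ((z.im⁻¹ * (1 + ((x - z.re) / z.im) ^ 2)⁻¹ : ℝ) : ℂ) := by
    intro x
    have e1 : ((x : ℂ) - z) * ((x : ℂ) - (starRingEnd ℂ) z)
        = (((x - z.re) ^ 2 + z.im ^ 2 : ℝ) : ℂ) := by
      have := mul_conj ((x : ℂ) - z)
      rw [map_sub, conj_ofReal] at this
      rw [this, normSq_apply]
      congr 1
      simp
      ring
    have e2 : z - (starRingEnd ℂ) z = 2 * I * (z.im : ℂ) := by
      rw [sub_conj]; push_cast; ring
    rw [e1, e2, mul_div_assoc, ← ofReal_div]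
    congr 2
    have : 0 < (x - z.re) ^ 2 + z.im ^ 2 := by positivity
    field_simp
    ring
  simp_rw [h2]
  rw [integral_const_mul, integral_complex_ofReal, h1]
  ring

/-- A bound for boundary values by the decay of the function inside. -/
theorem norm_shift_le {F : ℂ → ℂ} {C : ℝ}
    (hb : ∀ w ∈ upperPlane, ‖F w‖ ≤ C * (1 + ‖w‖ ^ 2)⁻¹) {w : ℂ} (hw : 0 ≤ w.im) {ε : ℝ}
    (hε : 0 < ε) : ‖F (w + I * ε)‖ ≤ C * (1 + ‖w‖ ^ 2)⁻¹ := by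
  have hmem : w + I * ε ∈ upperPlane := by
    simp only [upperPlane, Set.mem_ofPred_eq, add_im, mul_im, I_re, ofReal_im, I_im, ofReal_re]
    linarith
  have h1 := hb _ hmem
  have hC : 0 ≤ C := by
    have h2 := (norm_nonneg _).trans h1
    exact nonneg_of_mul_nonneg_left h2 (by positivity)
  refine h1.trans (mul_le_mul_of_nonneg_left ?_ hC)
  have h3 : ‖w‖ ^ 2 ≤ ‖w + I * ε‖ ^ 2 := by
    rw [← normSq_eq_norm_sq, ← normSq_eq_norm_sq, normSq_apply, normSq_apply]
    simp only [add_re, add_im, mul_re, mul_im, I_re, I_im, ofReal_re, ofReal_im]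
    nlinarith
  gcongr

theorem differentiableOn_shift {F : ℂ → ℂ} (hF : DifferentiableOn ℂ F upperPlane) (ε : ℝ) :
    DifferentiableOn ℂ (fun w => F (w + I * ε)) {w | -ε < w.im} := by
  refine hF.comp (by fun_prop) fun w hw => ?_
  simp only [Set.mem_ofPred_eq] at hw
  simp only [upperPlane, Set.mem_ofPred_eq, add_im, mul_im, I_re, ofReal_im, I_im, ofReal_re]
  linarith

/-- The shifted form of the Cauchy formula for the upper half-plane. -/
theorem integral_shift {F : ℂ → ℂ} {C : ℝ} (hF : DifferentiableOn ℂ F upperPlane)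
    (hb : ∀ w ∈ upperPlane, ‖F w‖ ≤ C * (1 + ‖w‖ ^ 2)⁻¹) {z : ℂ} (hz : 0 < z.im) {ε : ℝ}
    (hε : 0 < ε) :
    ∫ x : ℝ, F (x + I * ε) / (x - z) = 2 * Real.pi * I * F (z + I * ε) := by
  set zc := (starRingEnd ℂ) z with hzc
  have hzcim : zc.im = -z.im := by simp [hzc]
  set A := F (z + I * ε) with hA
  -- The subtracted term has value `A` at `z`, its pole in the lower half-plane and decay `1 / |w|`.
  -- So `h / (w - z)` has no pole above and decays quadratically, and the correction contributes a
  -- multiple of the Poisson mass.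
  set h : ℂ → ℂ := fun w => F (w + I * ε) - A * ((z - zc) / (w - zc)) with hh
  set U : Set ℂ := {w | -ε < w.im} ∩ {w | -z.im < w.im} with hU
  have hUopen : IsOpen U :=
    (isOpen_lt continuous_const continuous_im).inter (isOpen_lt continuous_const continuous_im)
  have hzU : z ∈ U := ⟨by simp only [Set.mem_ofPred_eq]; linarith,
    by simp only [Set.mem_ofPred_eq]; linarith⟩
  have hwne : ∀ w : ℂ, -z.im < w.im → w - zc ≠ 0 := by
    intro w hw h0
    have := congrArg im h0
    rw [sub_im, hzcim, zero_im] at this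
    linarith
  have hhd : DifferentiableOn ℂ h U := by
    refine ((differentiableOn_shift hF ε).mono Set.inter_subset_left).sub ?_
    refine DifferentiableOn.const_mul ?_ _
    exact (differentiableOn_const _).div (by fun_prop) fun w hw => hwne w hw.2
  have hhz : h z = 0 := by
    have : z - zc ≠ 0 := hwne z (by linarith)
    simp [hh, hA, div_self this]
  have hHd : DifferentiableOn ℂ (dslope h z) U :=
    (differentiableOn_dslope (hUopen.mem_nhds hzU)).2 hhd
  have hHval : ∀ w, w ≠ z → dslope h z w = h w / (w - z) := by
    intro w hw
    rw [dslope_of_ne _ hw, slope_def_field, hhz, sub_zero]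
  have hC : 0 ≤ C := by
    have h2 := (norm_nonneg _).trans (hb z hz)
    exact nonneg_of_mul_nonneg_left h2 (by positivity)
  have hmain := integral_real_eq_zero (H := dslope h z) (C := 2 * (C + 2 * (‖A‖ * ‖z - zc‖)))
    (R₀ := 2 * ‖z‖ + 1) (hHd.mono fun w hw => by
      simp only [Set.mem_ofPred_eq] at hw
      exact ⟨by simp only [Set.mem_ofPred_eq]; linarith, by simp only [Set.mem_ofPred_eq]; linarith⟩)
    (by linarith [norm_nonneg z]) (by
      intro w hw hwR
      have hn : 0 ≤ ‖z‖ := norm_nonneg z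
      have hw1 : 1 ≤ ‖w‖ := by linarith
      have hwpos : 0 < ‖w‖ := by linarith
      have hwz : w ≠ z := by
        rintro rfl
        linarith
      have d1 : ‖w‖ / 2 ≤ ‖w - z‖ := by
        have := norm_sub_norm_le w z
        linarith
      have d2 : ‖w‖ / 2 ≤ ‖w - zc‖ := by
        have := norm_sub_norm_le w zc
        rw [hzc, norm_conj, ← hzc] at this
        linarith
      have e1 : ‖F (w + I * ε)‖ ≤ C / ‖w‖ := by
        refine (norm_shift_le hb hw hε).trans ?_
        rw [div_eq_mul_inv]
        refine mul_le_mul_of_nonneg_left ?_ hC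
        apply inv_anti₀ hwpos
        nlinarith
      have e2 : ‖A * ((z - zc) / (w - zc))‖ ≤ 2 * (‖A‖ * ‖z - zc‖) / ‖w‖ := by
        rw [norm_mul, norm_div]
        calc ‖A‖ * (‖z - zc‖ / ‖w - zc‖) ≤ ‖A‖ * (‖z - zc‖ / (‖w‖ / 2)) := by gcongr
          _ = _ := by field_simp
      rw [hHval w hwz, norm_div]
      calc ‖h w‖ / ‖w - z‖ ≤ (C / ‖w‖ + 2 * (‖A‖ * ‖z - zc‖) / ‖w‖) / (‖w‖ / 2) := by
            gcongr
            exact (norm_sub_le _ _).trans (add_le_add e1 e2)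
        _ = _ := by field_simp)
  have hxz : ∀ x : ℝ, (x : ℂ) - z ≠ 0 := ofReal_sub_ne_zero hz.ne'
  have hxzc : ∀ x : ℝ, (x : ℂ) - zc ≠ 0 := ofReal_sub_ne_zero (by rw [hzcim]; linarith)
  have hpi : Integrable fun x : ℝ => (z - zc) / (((x : ℂ) - z) * ((x : ℂ) - zc)) := by
    -- A nonintegrable function has integral `0` by convention, so the nonzero Poisson mass already
    -- yields integrability.
    apply Integrable.of_integral_ne_zero
    rw [hzc, integral_poisson hz]
    simp [Real.pi_ne_zero]
  have hsplit : ∀ x : ℝ, F (x + I * ε) / (x - z)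
      = dslope h z x + A * ((z - zc) / (((x : ℂ) - z) * ((x : ℂ) - zc))) := by
    intro x
    rw [hHval _ (sub_ne_zero.1 (hxz x)), hh]
    have h1 := hxz x
    have h2 := hxzc x
    field_simp
    ring
  simp_rw [hsplit]
  rw [integral_add hmain.1 (hpi.const_mul A), hmain.2, integral_const_mul, hzc, integral_poisson hz]
  ring

/-- The Cauchy theorem for a pole in the lower half-plane, in shifted form. -/
theorem integral_shift_of_im_neg {F : ℂ → ℂ} {C : ℝ} (hF : DifferentiableOn ℂ F upperPlane)
    (hb : ∀ w ∈ upperPlane, ‖F w‖ ≤ C * (1 + ‖w‖ ^ 2)⁻¹) {z : ℂ} (hz : z.im < 0) {ε : ℝ}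
    (hε : 0 < ε) :
    ∫ x : ℝ, F (x + I * ε) / (x - z) = 0 := by
  have hne : ∀ w : ℂ, 0 ≤ w.im → w - z ≠ 0 := by
    intro w hw h0
    have := congrArg im h0
    rw [sub_im, zero_im] at this
    linarith
  have hC : 0 ≤ C := by
    have h2 := (norm_nonneg _).trans (hb I (by simp [upperPlane]))
    exact nonneg_of_mul_nonneg_left h2 (by positivity)
  refine (integral_real_eq_zero (H := fun w => F (w + I * ε) / (w - z)) (C := C / |z.im|)
    (R₀ := 1) ?_ le_rfl ?_).2
  · refine ((differentiableOn_shift hF ε).mono fun w hw => ?_).div (by fun_prop) hne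
    simp only [Set.mem_ofPred_eq] at hw ⊢
    linarith
  · intro w hw hw1
    have hzim : 0 < |z.im| := abs_pos.2 hz.ne
    have d1 : |z.im| ≤ ‖w - z‖ := by
      refine le_trans ?_ (abs_im_le_norm _)
      rw [sub_im, abs_of_neg hz]
      exact le_trans (by linarith) (le_abs_self _)
    rw [norm_div]
    calc ‖F (w + I * ε)‖ / ‖w - z‖ ≤ (C * (1 + ‖w‖ ^ 2)⁻¹) / |z.im| := by
          gcongr
          exact norm_shift_le hb hw hε
      _ ≤ (C * (‖w‖ ^ 2)⁻¹) / |z.im| := by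
          gcongr
          linarith
      _ = _ := by ring

/-! ### Passage to radial boundary values -/

section Boundary

variable {F : ℂ → ℂ} {C : ℝ} {F₀ : ℝ → ℂ}

theorem norm_boundary_le (hb : ∀ w ∈ upperPlane, ‖F w‖ ≤ C * (1 + ‖w‖ ^ 2)⁻¹)
    (hlim : ∀ x : ℝ, Tendsto (fun ε : ℝ => F (x + I * ε)) (𝓝[>] 0) (𝓝 (F₀ x))) (x : ℝ) :
    ‖F₀ x‖ ≤ C * (1 + x ^ 2)⁻¹ := by
  refine le_of_tendsto (hlim x).norm ?_
  filter_upwards [self_mem_nhdsWithin] with ε hε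
  have := norm_shift_le hb (w := (x : ℂ)) (by simp) hε
  simpa using this

theorem tendsto_one_div_nhdsGT :
    Tendsto (fun n : ℕ => 1 / ((n : ℝ) + 1)) atTop (𝓝[>] 0) :=
  tendsto_nhdsWithin_iff.2 ⟨tendsto_one_div_add_atTop_nhds_zero_nat,
    Eventually.of_forall fun n => by simp only [Set.mem_Ioi]; positivity⟩

theorem continuous_shift (hF : DifferentiableOn ℂ F upperPlane) {ε : ℝ} (hε : 0 < ε) :
    Continuous fun x : ℝ => F (x + I * ε) :=
  (differentiableOn_shift hF ε).continuousOn.comp_continuous continuous_ofReal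
    (fun x => by simpa using hε)

theorem continuous_ofReal_sub_inv {z : ℂ} (hz : z.im ≠ 0) :
    Continuous fun x : ℝ => ((x : ℂ) - z)⁻¹ :=
  Continuous.inv₀ (by fun_prop) (ofReal_sub_ne_zero hz)

theorem integrable_div_sub {ρ : ℝ → ℂ} (hρ : AEStronglyMeasurable ρ)
    (hb : ∀ x, ‖ρ x‖ ≤ C * (1 + x ^ 2)⁻¹) {z : ℂ} (hz : z.im ≠ 0) :
    Integrable fun x : ℝ => ρ x / ((x : ℂ) - z) := by
  have h1 : Integrable ρ :=
    (integrable_inv_one_add_sq.const_mul C).mono' hρ (ae_of_all _ hb)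
  simp_rw [div_eq_mul_inv]
  refine h1.mul_bdd (c := |z.im|⁻¹) (continuous_ofReal_sub_inv hz).aestronglyMeasurable
    (ae_of_all _ fun x => ?_)
  rw [norm_inv]
  exact inv_anti₀ (abs_pos.2 hz) (abs_im_le_norm_ofReal_sub x z)

theorem aestronglyMeasurable_boundary (hF : DifferentiableOn ℂ F upperPlane)
    (hlim : ∀ x : ℝ, Tendsto (fun ε : ℝ => F (x + I * ε)) (𝓝[>] 0) (𝓝 (F₀ x))) :
    AEStronglyMeasurable F₀ := by
  refine aestronglyMeasurable_of_tendsto_ae atTop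
    (f := fun (n : ℕ) (x : ℝ) => F (x + I * ((1 / ((n : ℝ) + 1) : ℝ) : ℂ)))
    (fun n => (continuous_shift hF (by positivity)).aestronglyMeasurable)
    (ae_of_all _ fun x => (hlim x).comp tendsto_one_div_nhdsGT)

/-- Dominated convergence: moving up does not decrease the modulus of a point with nonnegative
imaginary part, so one majorant serves all `ε`. -/
theorem tendsto_integral_shift (hF : DifferentiableOn ℂ F upperPlane)
    (hb : ∀ w ∈ upperPlane, ‖F w‖ ≤ C * (1 + ‖w‖ ^ 2)⁻¹)
    (hlim : ∀ x : ℝ, Tendsto (fun ε : ℝ => F (x + I * ε)) (𝓝[>] 0) (𝓝 (F₀ x))) {z : ℂ}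
    (hz : z.im ≠ 0) :
    Tendsto (fun ε : ℝ => ∫ x : ℝ, F (x + I * ε) / (x - z)) (𝓝[>] 0)
      (𝓝 (∫ x : ℝ, F₀ x / (x - z))) := by
  refine tendsto_integral_filter_of_dominated_convergence
    (fun x : ℝ => C * (1 + x ^ 2)⁻¹ * |z.im|⁻¹) ?_ ?_
    ((integrable_inv_one_add_sq.const_mul C).mul_const _)
    (ae_of_all _ fun x => (hlim x).div_const _)
  · filter_upwards [self_mem_nhdsWithin] with ε hε
    simp_rw [div_eq_mul_inv]
    exact ((continuous_shift hF hε).mul (continuous_ofReal_sub_inv hz)).aestronglyMeasurable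
  · filter_upwards [self_mem_nhdsWithin] with ε hε
    refine ae_of_all _ fun x => ?_
    have h1 := norm_shift_le hb (w := (x : ℂ)) (by simp) hε
    rw [norm_real, Real.norm_eq_abs, sq_abs] at h1
    rw [norm_div, div_eq_mul_inv]
    exact mul_le_mul h1 (inv_anti₀ (abs_pos.2 hz) (abs_im_le_norm_ofReal_sub x z))
      (by positivity) ((norm_nonneg _).trans h1)

/-- The Cauchy formula for the upper half-plane, with radial boundary values. -/
theorem integral_boundary (hF : DifferentiableOn ℂ F upperPlane)
    (hb : ∀ w ∈ upperPlane, ‖F w‖ ≤ C * (1 + ‖w‖ ^ 2)⁻¹)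
    (hlim : ∀ x : ℝ, Tendsto (fun ε : ℝ => F (x + I * ε)) (𝓝[>] 0) (𝓝 (F₀ x))) {z : ℂ}
    (hz : 0 < z.im) : ∫ x : ℝ, F₀ x / (x - z) = 2 * Real.pi * I * F z := by
  refine tendsto_nhds_unique (tendsto_integral_shift hF hb hlim hz.ne') ?_
  have hc : ContinuousAt F z :=
    (hF.differentiableAt ((isOpen_lt continuous_const continuous_im).mem_nhds hz)).continuousAt
  have h1 : Tendsto (fun ε : ℝ => z + I * (ε : ℂ)) (𝓝[>] 0) (𝓝 z) := by
    have : Continuous fun ε : ℝ => z + I * (ε : ℂ) := by fun_prop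
    simpa using (this.tendsto 0).mono_left nhdsWithin_le_nhds
  refine Tendsto.congr' ?_ ((hc.tendsto.comp h1).const_mul (2 * Real.pi * I))
  filter_upwards [self_mem_nhdsWithin] with ε hε
  exact (integral_shift hF hb hz hε).symm

/-- The Cauchy theorem for the upper half-plane, with radial boundary values and a pole in the
lower half-plane. -/
theorem integral_boundary_of_im_neg (hF : DifferentiableOn ℂ F upperPlane)
    (hb : ∀ w ∈ upperPlane, ‖F w‖ ≤ C * (1 + ‖w‖ ^ 2)⁻¹)
    (hlim : ∀ x : ℝ, Tendsto (fun ε : ℝ => F (x + I * ε)) (𝓝[>] 0) (𝓝 (F₀ x))) {z : ℂ}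
    (hz : z.im < 0) : ∫ x : ℝ, F₀ x / (x - z) = 0 := by
  refine tendsto_nhds_unique (tendsto_integral_shift hF hb hlim hz.ne) ?_
  refine Tendsto.congr' ?_ tendsto_const_nhds
  filter_upwards [self_mem_nhdsWithin] with ε hε
  exact (integral_shift_of_im_neg hF hb hz hε).symm

end Boundary

/-! ### Zeros and growth of functions of the class `𝓜` -/

theorem normSq_one_sub_div {w z : ℂ} (hz : z ≠ 0) :
    ‖1 - w / z‖ ^ 2 = ((z.re - w.re) ^ 2 + (z.im - w.im) ^ 2) / ‖z‖ ^ 2 := by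
  have h : 1 - w / z = (z - w) / z := by field_simp
  rw [h, norm_div, div_pow, ← normSq_eq_norm_sq (z - w), normSq_apply, sub_re, sub_im]
  ring

theorem ne_zero_of_mem_upperPlane {z : ℂ} (hz : z ∈ upperPlane) : z ≠ 0 := by
  rintro rfl
  simp [upperPlane] at hz

/-- Among points with the same real part, `‖f‖` does not decrease on moving away from the zeros. -/
theorem ClassM.norm_le_norm {f : ℂ → ℂ} (hf : ClassM f) {w₁ w₂ : ℂ} (hre : w₁.re = w₂.re)
    (him : |w₁.im| ≤ -w₂.im) : ‖f w₁‖ ≤ ‖f w₂‖ := by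
  obtain ⟨C, z, -, hz, hlim⟩ := hf.product
  refine le_of_tendsto_of_tendsto' (hlim w₁).norm (hlim w₂).norm fun N => ?_
  -- The comparison is factorwise: `w₂` is at least as far as `w₁` from every zero.
  rw [norm_mul, norm_mul, norm_prod, norm_prod]
  refine mul_le_mul_of_nonneg_left (Finset.prod_le_prod (fun _ _ => norm_nonneg _) fun n _ => ?_)
    (norm_nonneg _)
  have hn : 0 < (z n).im := hz n
  refine (pow_le_pow_iff_left₀ (norm_nonneg _) (norm_nonneg _) two_ne_zero).1 ?_
  rw [normSq_one_sub_div (ne_zero_of_mem_upperPlane (hz n)),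
    normSq_one_sub_div (ne_zero_of_mem_upperPlane (hz n)), hre]
  have := abs_le.1 him
  gcongr ?_ / _
  nlinarith

theorem ClassM.apply_zero_ne_zero {f : ℂ → ℂ} (hf : ClassM f) : f 0 ≠ 0 := by
  obtain ⟨C, z, hC, -, hlim⟩ := hf.product
  have := hlim 0
  simp only [zero_div, sub_zero, Finset.prod_const_one, mul_one] at this
  rwa [← tendsto_nhds_unique this tendsto_const_nhds] at hC

theorem one_add_sum_le_prod_one_add {t : ℕ → ℝ} (ht : ∀ n, 0 ≤ t n) (N : ℕ) :
    1 + ∑ n ∈ Finset.range N, t n ≤ ∏ n ∈ Finset.range N, (1 + t n) := by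
  induction N with
  | zero => simp
  | succ N ih =>
    rw [Finset.sum_range_succ, Finset.prod_range_succ]
    nlinarith [ht N, mul_nonneg (Finset.sum_nonneg fun n (_ : n ∈ Finset.range N) => ht n) (ht N)]

/-- The zeros in the product satisfy a Blaschke type condition. -/
theorem summable_of_tendsto_prod {z : ℕ → ℂ} (hz : ∀ n, z n ∈ upperPlane) {C a : ℂ} (hC : C ≠ 0)
    (hlim : Tendsto (fun N : ℕ => C * ∏ n ∈ Finset.range N, (1 - (-I) / z n)) atTop (𝓝 a)) :
    Summable fun n => (2 * (z n).im + 1) / ‖z n‖ ^ 2 := by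
  have hpos : ∀ n, 0 ≤ (2 * (z n).im + 1) / ‖z n‖ ^ 2 := fun n => by
    have : 0 < (z n).im := hz n
    positivity
  have hterm : ∀ n, ‖1 - (-I) / z n‖ ^ 2 = 1 + (2 * (z n).im + 1) / ‖z n‖ ^ 2 := by
    intro n
    have h0 : ‖z n‖ ^ 2 ≠ 0 := pow_ne_zero _ (norm_ne_zero_iff.2 (ne_zero_of_mem_upperPlane (hz n)))
    have h1 : ‖z n‖ ^ 2 = (z n).re ^ 2 + (z n).im ^ 2 := by
      rw [← normSq_eq_norm_sq, normSq_apply]; ring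
    rw [normSq_one_sub_div (ne_zero_of_mem_upperPlane (hz n))]
    simp only [neg_re, I_re, neg_im, I_im]
    rw [h1] at h0 ⊢
    field_simp
    ring
  -- At `-i` every squared factor is `1` plus a nonnegative term, so bounded partial products bound
  -- the partial sums.
  obtain ⟨M, hM⟩ := (hlim.norm.pow 2).bddAbove_range
  refine summable_of_sum_range_le (c := M / ‖C‖ ^ 2) hpos fun N => ?_
  have h1 := hM ⟨N, rfl⟩
  simp only [norm_mul, norm_prod, mul_pow, ← Finset.prod_pow, hterm] at h1
  rw [le_div_iff₀ (by positivity), mul_comm]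
  refine le_trans (mul_le_mul_of_nonneg_left ?_ (by positivity)) h1
  have := one_add_sum_le_prod_one_add hpos N
  linarith

/-- Otherwise zeros accumulate at `x`, so `f` vanishes identically, against `f 0 ≠ 0`. -/
theorem ClassM.exists_ne_zero_below {f : ℂ → ℂ} (hf : ClassM f) (x : ℝ) :
    ∃ y : ℝ, 0 < y ∧ f (x - y * I) ≠ 0 := by
  by_contra! h
  refine hf.apply_zero_ne_zero ?_
  have h1 : AnalyticOnNhd ℂ f Set.univ := fun z _ => hf.entire.analyticAt z
  have h2 : AnalyticOnNhd ℂ (fun _ : ℂ => (0 : ℂ)) Set.univ := fun z _ => analyticAt_const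
  refine congrFun (h1.eq_of_frequently_eq h2 (z₀ := (x : ℂ)) ?_) 0
  have ht : Tendsto (fun y : ℝ => (x : ℂ) - y * I) (𝓝[>] 0) (𝓝[≠] (x : ℂ)) := by
    refine tendsto_nhdsWithin_iff.2 ⟨?_, ?_⟩
    · have : Continuous fun y : ℝ => (x : ℂ) - y * I := by fun_prop
      simpa using (this.tendsto 0).mono_left nhdsWithin_le_nhds
    · filter_upwards [self_mem_nhdsWithin] with y hy
      have : (y : ℂ) ≠ 0 := by exact_mod_cast (ne_of_gt hy)
      simpa using this
  refine ht.frequently (Eventually.frequently ?_)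
  filter_upwards [self_mem_nhdsWithin] with y hy using h y hy

/-- Functions of the class `𝓜` have no zeros on the real line. -/
theorem ClassM.ofReal_ne_zero {f : ℂ → ℂ} (hf : ClassM f) (x : ℝ) : f x ≠ 0 := by
  obtain ⟨y, hy, hne⟩ := hf.exists_ne_zero_below x
  obtain ⟨C, z, hC, hz, hlim⟩ := hf.product
  set t : ℕ → ℝ := fun n => (2 * (z n).im + 1) / ‖z n‖ ^ 2 with ht
  have htsum : Summable t := summable_of_tendsto_prod hz hC (hlim (-I))
  -- Nonvanishing factors do not exclude a zero limit. The numbers `s n` measure the gain from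
  -- moving down by `y`: `|x - iy - z_n|² = |x - z_n|² (1 + s n)`.
  set s : ℕ → ℝ := fun n => (2 * y * (z n).im + y ^ 2) / ‖(x : ℂ) - z n‖ ^ 2 with hs
  have him : ∀ n, 0 < (z n).im := hz
  have hz0 : ∀ n, 0 < ‖z n‖ := fun n => norm_pos_iff.2 (ne_zero_of_mem_upperPlane (hz n))
  have hx0 : ∀ n, 0 < ‖(x : ℂ) - z n‖ := fun n =>
    norm_pos_iff.2 (ofReal_sub_ne_zero (him n).ne' x)
  have hs0 : ∀ n, 0 ≤ s n := fun n => by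
    have := him n
    have := hx0 n
    positivity
  have hssum : Summable s := by
    refine Summable.of_norm_bounded_eventually_nat (g := fun n => 4 * (2 * y + y ^ 2) * t n)
      (htsum.mul_left _) ?_
    -- Since `1 / |z_n|² ≤ t n`, this threshold forces `2|x| ≤ |z_n|` eventually, which makes `|x -
    -- z_n|` comparable to `|z_n|`.
    have hev := htsum.tendsto_atTop_zero.eventually_lt_const
      (u := ((2 * |x| + 1) ^ 2)⁻¹) (by positivity)
    filter_upwards [hev] with n hn
    rw [Real.norm_of_nonneg (hs0 n)]
    have h1 : 2 * |x| ≤ ‖z n‖ := by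
      by_contra hlt
      rw [not_le] at hlt
      have h2 : ((2 * |x| + 1) ^ 2)⁻¹ ≤ 1 / ‖z n‖ ^ 2 := by
        rw [one_div]
        have := hz0 n
        gcongr
        linarith
      have h3 : 1 / ‖z n‖ ^ 2 ≤ t n := by
        simp only [ht]
        gcongr
        linarith [him n]
      linarith
    have h2 : ‖z n‖ / 2 ≤ ‖(x : ℂ) - z n‖ := by
      have := norm_sub_norm_le (z n) x
      rw [norm_sub_rev, norm_real, Real.norm_eq_abs] at this
      linarith
    have h3 := hz0 n
    have h4 := him n
    calc s n ≤ ((2 * y + y ^ 2) * (2 * (z n).im + 1)) / (‖z n‖ / 2) ^ 2 := by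
          simp only [hs]
          gcongr
          nlinarith [mul_pos hy h4, mul_pos (pow_pos hy 2) h4]
      _ = 4 * (2 * y + y ^ 2) * t n := by
          simp only [ht]
          field_simp
          ring
  have hterm : ∀ n, ‖1 - ((x : ℂ) - y * I) / z n‖ ^ 2 = ‖1 - (x : ℂ) / z n‖ ^ 2 * (1 + s n) := by
    intro n
    have h1 : ‖(x : ℂ) - z n‖ ^ 2 = ((z n).re - x) ^ 2 + (z n).im ^ 2 := by
      rw [← normSq_eq_norm_sq, normSq_apply]
      simp
      ring
    have h2 := hz0 n
    have h3 := pow_pos (hx0 n) 2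
    rw [normSq_one_sub_div (ne_zero_of_mem_upperPlane (hz n)),
      normSq_one_sub_div (ne_zero_of_mem_upperPlane (hz n))]
    simp only [hs]
    simp only [sub_re, ofReal_re, mul_re, I_re, mul_zero, ofReal_im, I_im, mul_one, sub_self,
      sub_zero, sub_im, mul_im, add_zero, zero_sub, sub_neg_eq_add]
    rw [h1] at h3 ⊢
    field_simp
    ring
  -- The total gain is finite, so a zero at `x` would force one at `x - iy`.
  have hle : ‖f (x - y * I)‖ ^ 2 ≤ ‖f x‖ ^ 2 * Real.exp (∑' n, s n) := by
    refine le_of_tendsto_of_tendsto' ((hlim _).norm.pow 2)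
      (((hlim _).norm.pow 2).mul_const _) fun N => ?_
    simp only [norm_mul, norm_prod, mul_pow, ← Finset.prod_pow, hterm, Finset.prod_mul_distrib]
    rw [← mul_assoc]
    refine mul_le_mul_of_nonneg_left ?_ (by positivity)
    calc ∏ n ∈ Finset.range N, (1 + s n) ≤ ∏ n ∈ Finset.range N, Real.exp (s n) :=
          Finset.prod_le_prod (fun n _ => by linarith [hs0 n])
            fun n _ => by linarith [Real.add_one_le_exp (s n)]
      _ = Real.exp (∑ n ∈ Finset.range N, s n) := (Real.exp_sum _ _).symm
      _ ≤ _ := Real.exp_le_exp.2 (hssum.sum_le_tsum _ fun n _ => hs0 n)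
  intro h0
  rw [h0, norm_zero] at hle
  have : 0 < ‖f (x - y * I)‖ ^ 2 := by positivity
  linarith

/-- Functions of the class `𝓜` have no zeros in the closed lower half-plane. -/
theorem ClassM.ne_zero {f : ℂ → ℂ} (hf : ClassM f) {w : ℂ} (hw : w.im ≤ 0) : f w ≠ 0 := by
  have h1 := hf.norm_le_norm (w₁ := (w.re : ℂ)) (w₂ := w) (by simp) (by simpa using hw)
  exact norm_pos_iff.1 ((norm_pos_iff.2 (hf.ofReal_ne_zero w.re)).trans_le h1)

/-- Outside a large disc the decay condition for exponents `0` and `2` gives the constant `2`;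
inside, compactness and the absence of zeros give `M`. -/
theorem ClassM.norm_inv_le {f : ℂ → ℂ} (hf : ClassM f) :
    ∃ C : ℝ, 0 < C ∧ ∀ w : ℂ, w.im ≤ 0 → ‖(f w)⁻¹‖ ≤ C * (1 + ‖w‖ ^ 2)⁻¹ := by
  have h0 := ((hf.decay 0).norm.eventually_le_const (u := 1) (by simp))
  have h2 := ((hf.decay 2).norm.eventually_le_const (u := 1) (by simp))
  have h := h0.and h2
  rw [eventually_inf_principal, ← comap_norm_atTop, eventually_comap] at h
  obtain ⟨R, hR⟩ := eventually_atTop.1 h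
  have hK : IsCompact (Metric.closedBall (0 : ℂ) R ∩ {w : ℂ | w.im ≤ 0}) :=
    (isCompact_closedBall _ _).inter_right (isClosed_le continuous_im continuous_const)
  have hcont : ContinuousOn (fun w : ℂ => (f w)⁻¹ * (1 + ‖w‖ ^ 2 : ℝ))
      (Metric.closedBall (0 : ℂ) R ∩ {w : ℂ | w.im ≤ 0}) := by
    refine ContinuousOn.mul (hf.entire.continuous.continuousOn.inv₀ fun w hw => hf.ne_zero hw.2) ?_
    exact Continuous.continuousOn (by fun_prop)
  obtain ⟨M, hM⟩ := hK.exists_bound_of_continuousOn hcont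
  refine ⟨max M 2, by positivity, fun w hw => ?_⟩
  have hpos : 0 < 1 + ‖w‖ ^ 2 := by positivity
  rw [← div_eq_mul_inv, le_div_iff₀ hpos]
  by_cases hwR : ‖w‖ ≤ R
  · refine le_trans ?_ ((hM w ⟨by simpa using hwR, hw⟩).trans (le_max_left _ _))
    rw [norm_mul, norm_real, Real.norm_of_nonneg hpos.le]
  · obtain ⟨k0, k2⟩ := hR ‖w‖ (not_le.1 hwR).le w rfl hw
    rw [pow_zero, one_div] at k0
    rw [norm_div, norm_pow, div_eq_mul_inv, ← norm_inv] at k2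
    refine le_trans ?_ (le_max_right _ _)
    nlinarith

theorem reflect_ofReal (f : ℂ → ℂ) (x : ℝ) : reflect f x = (starRingEnd ℂ) (f x) := by
  rw [reflect, conj_ofReal]

theorem ClassM.reflect_ne_zero {f : ℂ → ℂ} (hf : ClassM f) {w : ℂ} (hw : 0 ≤ w.im) :
    reflect f w ≠ 0 := by
  rw [reflect, Ne, map_eq_zero]
  exact hf.ne_zero (by simpa using hw)

theorem ClassM.norm_reflect_inv_le {f : ℂ → ℂ} (hf : ClassM f) :
    ∃ C : ℝ, 0 < C ∧ ∀ w : ℂ, 0 ≤ w.im → ‖(reflect f w)⁻¹‖ ≤ C * (1 + ‖w‖ ^ 2)⁻¹ := by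
  obtain ⟨C, hC, h⟩ := hf.norm_inv_le
  refine ⟨C, hC, fun w hw => ?_⟩
  have := h ((starRingEnd ℂ) w) (by simpa using hw)
  rwa [norm_conj, norm_inv, ← norm_conj, ← norm_inv] at this

theorem ClassM.norm_le_norm_reflect {f : ℂ → ℂ} (hf : ClassM f) {w : ℂ} (hw : 0 ≤ w.im) :
    ‖f w‖ ≤ ‖reflect f w‖ := by
  rw [reflect, norm_conj]
  exact hf.norm_le_norm (by simp) (by simp [abs_of_nonneg hw])

/-! ### Difference quotients of entire functions and their integrals -/

theorem dslope_comm (f : ℂ → ℂ) (a b : ℂ) : dslope f a b = dslope f b a := by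
  rcases eq_or_ne a b with rfl | h
  · rfl
  · rw [dslope_of_ne _ h.symm, dslope_of_ne _ h, slope_comm]

theorem differentiable_dslope {f : ℂ → ℂ} (hf : Differentiable ℂ f) (a : ℂ) :
    Differentiable ℂ (dslope f a) :=
  differentiableOn_univ.1 ((differentiableOn_dslope univ_mem).2 hf.differentiableOn)

/-- A locally uniform bound for difference quotients of an entire function. -/
theorem exists_norm_dslope_le {f : ℂ → ℂ} (hf : Differentiable ℂ f) (R : ℝ) :
    ∃ M : ℝ, ∀ a z : ℂ, ‖z‖ ≤ R → ‖dslope f a z‖ ≤ M + ‖f a‖ := by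
  have hf' : Continuous (deriv f) := (hf.contDiff (n := 1)).continuous_deriv le_rfl
  obtain ⟨M₁, hM₁⟩ := (isCompact_closedBall (0 : ℂ) (R + 1)).exists_bound_of_continuousOn
    hf'.continuousOn
  obtain ⟨M₂, hM₂⟩ := (isCompact_closedBall (0 : ℂ) (R + 1)).exists_bound_of_continuousOn
    hf.continuous.continuousOn
  refine ⟨max M₁ M₂, fun a z hz => ?_⟩
  have hzmem : z ∈ Metric.closedBall (0 : ℂ) (R + 1) := by
    simp only [mem_closedBall_zero_iff]; linarith
  rcases eq_or_ne z a with rfl | hne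
  · rw [dslope_same]
    exact (hM₁ z hzmem).trans ((le_max_left _ _).trans (le_add_of_nonneg_right (norm_nonneg _)))
  rw [dslope_of_ne _ hne, slope_def_field, norm_div]
  have hpos : 0 < ‖z - a‖ := norm_pos_iff.2 (sub_ne_zero.2 hne)
  rw [div_le_iff₀ hpos]
  -- Near the disc the mean value inequality applies; farther out the denominator is at least `1`.
  by_cases ha : ‖a‖ ≤ R + 1
  · refine ((convex_closedBall (0 : ℂ) (R + 1)).norm_image_sub_le_of_norm_deriv_le
      (fun w _ => hf w) hM₁ (by simpa using ha) hzmem).trans ?_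
    refine mul_le_mul_of_nonneg_right ?_ hpos.le
    exact (le_max_left _ _).trans (le_add_of_nonneg_right (norm_nonneg _))
  · have h1 : 1 ≤ ‖z - a‖ := by
      have := norm_sub_norm_le a z
      rw [norm_sub_rev] at this
      linarith
    have h2 : ‖f z - f a‖ ≤ max M₁ M₂ + ‖f a‖ :=
      (norm_sub_le _ _).trans (add_le_add_left ((hM₂ z hzmem).trans (le_max_right _ _)) _)
    exact h2.trans (le_mul_of_one_le_right ((norm_nonneg _).trans h2) h1)

/-- The transform of an integrable density by the difference quotients of an entire function is
entire. -/
theorem differentiable_integral_dslope {f : ℂ → ℂ} (hf : Differentiable ℂ f) {ρ : ℝ → ℂ}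
    (h1 : Integrable ρ) (h2 : Integrable fun x : ℝ => f x * ρ x) :
    Differentiable ℂ fun z => ∫ x : ℝ, dslope f x z * ρ x := by
  intro z₀
  -- Radius `‖z₀‖ + 2` contains the unit circles about points of the unit ball at `z₀`, as the
  -- Cauchy estimate for the derivative requires.
  obtain ⟨M, hM⟩ := exists_norm_dslope_le hf (‖z₀‖ + 2)
  set bound : ℝ → ℝ := fun x => (M + ‖f x‖) * ‖ρ x‖ with hbound
  have hbint : Integrable bound := by
    have : bound = fun x : ℝ => M * ‖ρ x‖ + ‖f x * ρ x‖ := by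
      funext x
      rw [hbound, norm_mul]
      ring
    rw [this]
    exact (h1.norm.const_mul M).add h2.norm
  have hmeas : ∀ z : ℂ, AEStronglyMeasurable fun x : ℝ => dslope f x z * ρ x := by
    intro z
    refine AEStronglyMeasurable.mul ?_ h1.aestronglyMeasurable
    simp_rw [dslope_comm f _ z]
    exact ((differentiable_dslope hf z).continuous.comp continuous_ofReal).aestronglyMeasurable
  have hder : ∀ (x : ℝ) (z : ℂ),
      HasDerivAt (fun z => dslope f x z * ρ x) (deriv (dslope f x) z * ρ x) z := fun x z =>
    ((differentiable_dslope hf x) z).hasDerivAt.mul_const _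
  refine (hasDerivAt_integral_of_dominated_loc_of_deriv_le (bound := bound)
    (F' := fun z x => deriv (dslope f (x : ℂ)) z * ρ x) (Metric.ball_mem_nhds z₀ one_pos)
    (Eventually.of_forall hmeas) ?_ ?_ ?_ hbint
    (ae_of_all _ fun x z _ => hder x z)).2.differentiableAt
  · refine hbint.mono' (hmeas z₀) (ae_of_all _ fun x => ?_)
    rw [norm_mul]
    exact mul_le_mul_of_nonneg_right (hM _ _ (by linarith)) (norm_nonneg _)
  -- The derivative is measurable in `x` as a pointwise limit of difference quotients in `z`.
  · have ht : Tendsto (fun n : ℕ => z₀ + ((1 / ((n : ℝ) + 1) : ℝ) : ℂ)) atTop (𝓝[≠] z₀) := by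
      refine tendsto_nhdsWithin_iff.2 ⟨?_, Eventually.of_forall fun n => ?_⟩
      · have h := ((continuous_ofReal.tendsto 0).comp
          (tendsto_one_div_add_atTop_nhds_zero_nat (𝕜 := ℝ))).const_add z₀
        simpa [Function.comp_def] using h
      · have : (0 : ℝ) < 1 / ((n : ℝ) + 1) := by positivity
        have h : ((1 / ((n : ℝ) + 1) : ℝ) : ℂ) ≠ 0 := by exact_mod_cast this.ne'
        simpa only [Set.mem_compl_iff, Set.mem_singleton_iff, add_eq_left] using h
    refine aestronglyMeasurable_of_tendsto_ae atTop
      (f := fun (n : ℕ) (x : ℝ) => slope (fun z => dslope f (x : ℂ) z * ρ x) z₀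
        (z₀ + ((1 / ((n : ℝ) + 1) : ℝ) : ℂ))) (fun n => ?_)
      (ae_of_all _ fun x => (hder x z₀).tendsto_slope.comp ht)
    simp only [slope_def_field]
    simp_rw [div_eq_mul_inv]
    exact ((hmeas _).sub (hmeas _)).mul_const _
  · refine ae_of_all _ fun x z hz => ?_
    rw [norm_mul]
    refine mul_le_mul_of_nonneg_right ?_ (norm_nonneg _)
    have h := norm_deriv_le_of_forall_mem_sphere_norm_le (c := z) (C := M + ‖f x‖) one_pos
      (differentiable_dslope hf x).diffContOnCl (fun w hw => hM _ _ ?_)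
    · simpa using h
    · have e1 : ‖w - z‖ = 1 := by simpa [dist_eq_norm] using hw
      have e2 : ‖z - z₀‖ < 1 := by simpa [dist_eq_norm] using hz
      have e3 : w = (w - z) + ((z - z₀) + z₀) := by ring
      rw [e3]
      refine (norm_add_le _ _).trans ?_
      have := norm_add_le (z - z₀) z₀
      linarith

/-! ### The entire continuation `g` and the determinant identity -/

theorem boundaryValue_const (c : ℂ) (x : ℝ) : boundaryValue (fun _ => c) x = c :=
  tendsto_const_nhds.limUnder_eq

section Continuation

variable {f : ℂ → ℂ}

theorem mu_I (f : ℂ → ℂ) (x : ℝ) : mu (fun _ => I) f x = (Real.pi)⁻¹ * (‖f x‖ ^ 2)⁻¹ := by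
  have h : compIm f x - I * compRe f x = -I * reflect f x := by
    simp only [compIm, compRe]
    ring
  rw [mu, boundaryValue_const, h, norm_mul, reflect_ofReal, norm_conj]
  simp [div_eq_mul_inv]

theorem mu_I_ofReal (f : ℂ → ℂ) (x : ℝ) :
    (mu (fun _ => I) f x : ℂ) = (Real.pi : ℂ)⁻¹ * ((f x)⁻¹ * (reflect f x)⁻¹) := by
  rw [mu_I, reflect_ofReal, ← mul_inv (f x), mul_conj, normSq_eq_norm_sq]
  push_cast
  ring

theorem ClassM.continuous_mu (hf : ClassM f) :
    Continuous fun x : ℝ => (mu (fun _ => I) f x : ℂ) := by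
  simp_rw [mu_I]
  have hc : Continuous fun x : ℝ => ‖f x‖ ^ 2 :=
    ((hf.entire.continuous.comp continuous_ofReal).norm).pow 2
  refine continuous_ofReal.comp (continuous_const.mul (hc.inv₀ fun x => ?_))
  have := hf.ofReal_ne_zero x
  positivity

theorem ClassM.norm_mu_le (hf : ClassM f) :
    ∃ C : ℝ, ∀ x : ℝ, ‖(mu (fun _ => I) f x : ℂ)‖ ≤ C * (1 + x ^ 2)⁻¹ := by
  obtain ⟨C, hC, h⟩ := hf.norm_inv_le
  refine ⟨Real.pi⁻¹ * C ^ 2, fun x => ?_⟩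
  have h1 := h x (by simp)
  rw [norm_real, Real.norm_eq_abs, sq_abs] at h1
  rw [mu_I_ofReal, reflect_ofReal, norm_mul, norm_mul, ← map_inv₀, norm_conj,
    norm_inv (Real.pi : ℂ), norm_real, Real.norm_of_nonneg Real.pi_pos.le, mul_assoc]
  refine mul_le_mul_of_nonneg_left ?_ (inv_nonneg.2 Real.pi_pos.le)
  have h2 : (1 + x ^ 2)⁻¹ ≤ 1 := inv_le_one_of_one_le₀ (by nlinarith [sq_nonneg x])
  have h3 : 0 < (1 + x ^ 2)⁻¹ := by positivity
  calc ‖(f x)⁻¹‖ * ‖(f x)⁻¹‖ ≤ (C * (1 + x ^ 2)⁻¹) * (C * (1 + x ^ 2)⁻¹) := by gcongr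
    _ = C ^ 2 * (1 + x ^ 2)⁻¹ * (1 + x ^ 2)⁻¹ := by ring
    _ ≤ C ^ 2 * (1 + x ^ 2)⁻¹ * 1 := by gcongr
    _ = _ := mul_one _

theorem ClassM.integrable_mu (hf : ClassM f) :
    Integrable fun x : ℝ => (mu (fun _ => I) f x : ℂ) := by
  obtain ⟨C, h⟩ := hf.norm_mu_le
  exact (integrable_inv_one_add_sq.const_mul C).mono' hf.continuous_mu.aestronglyMeasurable
    (ae_of_all _ h)

theorem ClassM.integrable_mu_div (hf : ClassM f) {z : ℂ} (hz : z.im ≠ 0) :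
    Integrable fun x : ℝ => (mu (fun _ => I) f x : ℂ) / ((x : ℂ) - z) := by
  obtain ⟨C, h⟩ := hf.norm_mu_le
  exact integrable_div_sub hf.continuous_mu.aestronglyMeasurable h hz

/-- Multiplication by `f` cancels the factor with zeros above the line and leaves the boundary
values of a function analytic in the upper half-plane. -/
theorem ClassM.mul_mu (hf : ClassM f) (x : ℝ) :
    f x * (mu (fun _ => I) f x : ℂ) = (Real.pi : ℂ)⁻¹ * (reflect f x)⁻¹ := by
  rw [mu_I_ofReal]
  have := hf.ofReal_ne_zero x
  field_simp

theorem ClassM.differentiableOn_reflect_inv (hf : ClassM f) :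
    DifferentiableOn ℂ (fun w => (reflect f w)⁻¹) upperPlane :=
  (differentiable_reflect hf.entire).differentiableOn.inv fun _ hw => hf.reflect_ne_zero (le_of_lt hw)

theorem tendsto_vertical {h : ℂ → ℂ} (hh : Continuous h) (x : ℝ) :
    Tendsto (fun ε : ℝ => h (x + I * ε)) (𝓝[>] 0) (𝓝 (h x)) := by
  have : Continuous fun ε : ℝ => h (x + I * ε) := by fun_prop
  simpa using (this.tendsto 0).mono_left nhdsWithin_le_nhds

theorem ClassM.tendsto_reflect_inv (hf : ClassM f) (x : ℝ) :
    Tendsto (fun ε : ℝ => (reflect f (x + I * ε))⁻¹) (𝓝[>] 0) (𝓝 (reflect f x)⁻¹) :=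
  (tendsto_vertical (differentiable_reflect hf.entire).continuous x).inv₀
    (hf.reflect_ne_zero (by simp))

theorem ClassM.continuous_reflect_inv (hf : ClassM f) :
    Continuous fun x : ℝ => (reflect f x)⁻¹ :=
  ((differentiable_reflect hf.entire).continuous.comp continuous_ofReal).inv₀
    fun x => hf.reflect_ne_zero (by simp)

/-- The entire continuation of `gLower f`. -/
def gEntire (f : ℂ → ℂ) (z : ℂ) : ℂ := ∫ x : ℝ, dslope f x z * (mu (fun _ => I) f x : ℂ)

theorem ClassM.differentiable_gEntire (hf : ClassM f) : Differentiable ℂ (gEntire f) := by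
  refine differentiable_integral_dslope hf.entire hf.integrable_mu ?_
  simp_rw [hf.mul_mu]
  obtain ⟨C, hC, h⟩ := hf.norm_reflect_inv_le
  refine Integrable.const_mul ?_ _
  refine (integrable_inv_one_add_sq.const_mul C).mono'
    hf.continuous_reflect_inv.aestronglyMeasurable (ae_of_all _ fun x => ?_)
  simpa using h x (by simp)

theorem ClassM.gEntire_eq (hf : ClassM f) {z : ℂ} (hz : z.im ≠ 0) :
    gEntire f z = (Real.pi : ℂ)⁻¹ * (∫ x : ℝ, (reflect f x)⁻¹ / ((x : ℂ) - z))
      - f z * stieltjes (fun _ => I) f z := by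
  have h1 : ∀ x : ℝ, dslope f x z * (mu (fun _ => I) f x : ℂ)
      = (Real.pi : ℂ)⁻¹ * ((reflect f x)⁻¹ / ((x : ℂ) - z))
        - f z * ((mu (fun _ => I) f x : ℂ) / ((x : ℂ) - z)) := by
    intro x
    have hne := ofReal_sub_ne_zero hz x
    rw [dslope_comm, dslope_of_ne _ (sub_ne_zero.1 hne), slope_def_field, ← mul_div_assoc,
      ← hf.mul_mu]
    field_simp
  obtain ⟨C, hC, h⟩ := hf.norm_reflect_inv_le
  have hint : Integrable fun x : ℝ => (reflect f x)⁻¹ / ((x : ℂ) - z) :=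
    integrable_div_sub (C := C) hf.continuous_reflect_inv.aestronglyMeasurable
      (fun x => by simpa using h x (by simp)) hz
  rw [gEntire, stieltjes]
  simp_rw [h1]
  rw [integral_sub (hint.const_mul _) ((hf.integrable_mu_div hz).const_mul _), integral_const_mul,
    integral_const_mul]

theorem ClassM.gEntire_eq_gLower (hf : ClassM f) {z : ℂ} (hz : z.im < 0) :
    gEntire f z = gLower f z := by
  obtain ⟨C, hC, h⟩ := hf.norm_reflect_inv_le
  rw [hf.gEntire_eq hz.ne, integral_boundary_of_im_neg hf.differentiableOn_reflect_inv
    (fun w hw => h w (le_of_lt hw)) hf.tendsto_reflect_inv hz, gLower]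
  ring

theorem ClassM.gEntire_eq_upper (hf : ClassM f) {z : ℂ} (hz : 0 < z.im) :
    gEntire f z = 2 * I / reflect f z - f z * stieltjes (fun _ => I) f z := by
  obtain ⟨C, hC, h⟩ := hf.norm_reflect_inv_le
  have hpi : (Real.pi : ℂ) ≠ 0 := by exact_mod_cast Real.pi_ne_zero
  rw [hf.gEntire_eq hz.ne', integral_boundary hf.differentiableOn_reflect_inv
    (fun w hw => h w (le_of_lt hw)) hf.tendsto_reflect_inv hz]
  field_simp

theorem reflect_stieltjes (φ f : ℂ → ℂ) (z : ℂ) :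
    reflect (stieltjes φ f) z = stieltjes φ f z := by
  rw [reflect, stieltjes, ← integral_conj, stieltjes]
  simp

/-- The conjugate of `z` lies below the line, where the continuation is `-f S`; the density is real,
so `S` is its own reflection. -/
theorem ClassM.reflect_gEntire (hf : ClassM f) {z : ℂ} (hz : 0 < z.im) :
    reflect (gEntire f) z = -(reflect f z * stieltjes (fun _ => I) f z) := by
  rw [reflect, hf.gEntire_eq_gLower (by simpa using hz), gLower, neg_mul, map_neg, map_mul,
    ← reflect, ← reflect, reflect_stieltjes]

/-- The Wronskian type identity for `f` and the continuation of `gLower f`. -/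
theorem ClassM.reflect_mul_gEntire_sub (hf : ClassM f) (z : ℂ) :
    reflect f z * gEntire f z - f z * reflect (gEntire f) z = 2 * I := by
  have hg := hf.differentiable_gEntire
  have hd : Differentiable ℂ fun z => reflect f z * gEntire f z - f z * reflect (gEntire f) z :=
    ((differentiable_reflect hf.entire).mul hg).sub (hf.entire.mul (differentiable_reflect hg))
  have h1 : AnalyticOnNhd ℂ
      (fun z => reflect f z * gEntire f z - f z * reflect (gEntire f) z) Set.univ :=
    fun z _ => hd.analyticAt z
  have h2 : AnalyticOnNhd ℂ (fun _ : ℂ => 2 * I) Set.univ := fun z _ => analyticAt_const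
  -- By the identity theorem a neighbourhood of `i` suffices; there the formulas above the line
  -- apply and `S` cancels.
  refine congrFun (h1.eq_of_eventuallyEq h2 (z₀ := I) ?_) z
  filter_upwards [(isOpen_lt continuous_const continuous_im).mem_nhds
    (show (0 : ℝ) < I.im by simp)] with w hw
  have hne := hf.reflect_ne_zero (le_of_lt hw)
  rw [hf.gEntire_eq_upper hw, hf.reflect_gEntire hw]
  field_simp
  ring

end Continuation

/-! ### General parameters through the Cayley transform -/

/-- The Cayley transform of the upper half-plane onto the unit disc. -/
def cayley (p : ℂ) : ℂ := (p - I) / (p + I)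

theorem add_I_ne_zero {p : ℂ} (hp : p ∈ upperPlane) : p + I ≠ 0 := by
  intro h
  have h1 := congrArg im h
  have h2 : 0 < p.im := hp
  simp only [add_im, I_im, zero_im] at h1
  linarith

theorem norm_cayley_lt_one {p : ℂ} (hp : p ∈ upperPlane) : ‖cayley p‖ < 1 := by
  have h2 : 0 < p.im := hp
  rw [cayley, norm_div, div_lt_one (norm_pos_iff.2 (add_I_ne_zero hp))]
  refine lt_of_pow_lt_pow_left₀ 2 (norm_nonneg _) ?_
  rw [← normSq_eq_norm_sq, ← normSq_eq_norm_sq, normSq_apply, normSq_apply]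
  simp only [sub_re, sub_im, add_re, add_im, I_re, I_im]
  nlinarith

section Parameter

variable {f φ : ℂ → ℂ}

theorem ClassPb.tendsto_boundaryValue (hφ : ClassPb φ) (x : ℝ) :
    Tendsto (fun ε : ℝ => φ (x + I * ε)) (𝓝[>] 0) (𝓝 (boundaryValue φ x)) :=
  (hφ.boundary {x} isCompact_singleton).tendsto_at rfl

theorem ClassPb.boundaryValue_mem (hφ : ClassPb φ) (x : ℝ) :
    boundaryValue φ x ∈ closure (φ '' upperPlane) := by
  refine isClosed_closure.mem_of_tendsto (hφ.tendsto_boundaryValue x) ?_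
  filter_upwards [self_mem_nhdsWithin] with ε hε
  refine subset_closure (Set.mem_image_of_mem _ ?_)
  simpa [upperPlane] using hε

/-- The closure of the image is compact in the upper half-plane, so the modulus attains a maximum
below `1`. This uniform gap controls the denominators below. -/
theorem ClassPb.exists_norm_cayley_le (hφ : ClassPb φ) :
    ∃ δ < 1, ∀ p ∈ closure (φ '' upperPlane), ‖cayley p‖ ≤ δ := by
  have hK : IsCompact (closure (φ '' upperPlane)) :=
    Metric.isCompact_of_isClosed_isBounded isClosed_closure hφ.bounded
  have hne : (closure (φ '' upperPlane)).Nonempty :=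
    ⟨φ I, subset_closure (Set.mem_image_of_mem _ (by simp [upperPlane]))⟩
  have hc : ContinuousOn (fun p => ‖cayley p‖) (closure (φ '' upperPlane)) := by
    unfold cayley
    exact (ContinuousOn.div (by fun_prop) (by fun_prop)
      fun p hp => add_I_ne_zero (hφ.closure_subset hp)).norm
  obtain ⟨p, hp, hmax⟩ := hK.exists_isMaxOn hne hc
  exact ⟨_, norm_cayley_lt_one (hφ.closure_subset hp), fun q hq => hmax hq⟩

theorem ClassM.one_sub_mul_norm_le (hf : ClassM f) {w θ : ℂ} {δ : ℝ} (hw : 0 ≤ w.im)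
    (hθ : ‖θ‖ ≤ δ) : (1 - δ) * ‖reflect f w‖ ≤ ‖f w * θ + reflect f w‖ := by
  have h1 := norm_sub_le_norm_add (reflect f w) (f w * θ)
  rw [add_comm, norm_mul] at h1
  have h2 : ‖f w‖ * ‖θ‖ ≤ ‖reflect f w‖ * δ :=
    mul_le_mul (hf.norm_le_norm_reflect hw) hθ (norm_nonneg _) (norm_nonneg _)
  linarith

theorem ClassM.add_reflect_ne_zero (hf : ClassM f) {w θ : ℂ} (hw : 0 ≤ w.im) (hθ : ‖θ‖ < 1) :
    f w * θ + reflect f w ≠ 0 := by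
  have h1 := hf.one_sub_mul_norm_le hw (le_refl ‖θ‖)
  have h2 : 0 < ‖reflect f w‖ := norm_pos_iff.2 (hf.reflect_ne_zero hw)
  have h3 : 0 < (1 - ‖θ‖) * ‖reflect f w‖ := mul_pos (by linarith) h2
  exact norm_pos_iff.1 (h3.trans_le h1)

/-- The difference between the Stieltjes transforms for a parameter `p` and for `I`. -/
def stieltjesDiff (f : ℂ → ℂ) (p w : ℂ) : ℂ :=
  -(2 * I * cayley p) / (reflect f w * (f w * cayley p + reflect f w))

theorem ClassM.norm_stieltjesDiff_le (hf : ClassM f) {δ : ℝ} (hδ : δ < 1) :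
    ∃ C : ℝ, ∀ w p : ℂ, 0 ≤ w.im → ‖cayley p‖ ≤ δ →
      ‖stieltjesDiff f p w‖ ≤ C * (1 + ‖w‖ ^ 2)⁻¹ := by
  obtain ⟨C, hC, h⟩ := hf.norm_reflect_inv_le
  have hδ' : 0 < 1 - δ := by linarith
  refine ⟨2 / (1 - δ) * C ^ 2, fun w p hw hp => ?_⟩
  have h1 := h w hw
  have h0 : 0 < ‖reflect f w‖ := norm_pos_iff.2 (hf.reflect_ne_zero hw)
  have h2 : (1 + ‖w‖ ^ 2)⁻¹ ≤ 1 := inv_le_one_of_one_le₀ (by nlinarith [sq_nonneg ‖w‖])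
  have h3 := hf.one_sub_mul_norm_le hw hp
  rw [stieltjesDiff, norm_div, norm_neg, norm_mul, norm_mul, norm_mul, norm_I, mul_one, norm_ofNat]
  calc 2 * ‖cayley p‖ / (‖reflect f w‖ * ‖f w * cayley p + reflect f w‖)
      ≤ 2 * 1 / (‖reflect f w‖ * ((1 - δ) * ‖reflect f w‖)) := by
        gcongr
        linarith
    _ = 2 / (1 - δ) * (‖(reflect f w)⁻¹‖ * ‖(reflect f w)⁻¹‖) := by
        rw [norm_inv]
        field_simp
    _ ≤ 2 / (1 - δ) * ((C * (1 + ‖w‖ ^ 2)⁻¹) * (C * (1 + ‖w‖ ^ 2)⁻¹)) := by gcongr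
    _ = 2 / (1 - δ) * C ^ 2 * (1 + ‖w‖ ^ 2)⁻¹ * (1 + ‖w‖ ^ 2)⁻¹ := by ring
    _ ≤ 2 / (1 - δ) * C ^ 2 * (1 + ‖w‖ ^ 2)⁻¹ * 1 := by gcongr
    _ = _ := mul_one _

theorem ClassM.differentiableOn_stieltjesDiff (hf : ClassM f) (hφ : IsPick φ) :
    DifferentiableOn ℂ (fun w => stieltjesDiff f (φ w) w) upperPlane := by
  have h1 : DifferentiableOn ℂ (fun w => cayley (φ w)) upperPlane := by
    unfold cayley
    exact (hφ.analytic.sub_const I).div (hφ.analytic.add_const I)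
      fun w hw => add_I_ne_zero (hφ.mapsTo hw)
  have h2 := (differentiable_reflect hf.entire).differentiableOn (s := upperPlane)
  unfold stieltjesDiff
  refine (h1.const_mul (2 * I)).neg.div (h2.mul ((hf.entire.differentiableOn.mul h1).add h2)) ?_
  intro w hw
  have hw' : 0 ≤ w.im := le_of_lt hw
  exact mul_ne_zero (hf.reflect_ne_zero hw')
    (hf.add_reflect_ne_zero hw' (norm_cayley_lt_one (hφ.mapsTo hw)))

theorem ClassM.tendsto_stieltjesDiff (hf : ClassM f) (hφ : ClassPb φ) (x : ℝ) :
    Tendsto (fun ε : ℝ => stieltjesDiff f (φ (x + I * ε)) (x + I * ε)) (𝓝[>] 0)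
      (𝓝 (stieltjesDiff f (boundaryValue φ x) x)) := by
  have hp := hφ.closure_subset (hφ.boundaryValue_mem x)
  have h0 := hφ.tendsto_boundaryValue x
  have h1 := (h0.sub_const I).div (h0.add_const I) (add_I_ne_zero hp)
  have h2 := tendsto_vertical (differentiable_reflect hf.entire).continuous x
  have h3 := tendsto_vertical hf.entire.continuous x
  exact (h1.const_mul (2 * I)).neg.div (h2.mul ((h3.mul h1).add h2))
    (mul_ne_zero (hf.reflect_ne_zero (by simp))
      (hf.add_reflect_ne_zero (by simp) (norm_cayley_lt_one hp)))

theorem compRe_mul_sub_compIm (h : ℂ → ℂ) {p : ℂ} (hp : p ∈ upperPlane) (w : ℂ) :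
    compRe h w * p - compIm h w = (p + I) / 2 * (h w * cayley p + reflect h w) := by
  have := add_I_ne_zero hp
  rw [cayley, compRe, compIm]
  field_simp
  ring

/-- Uses `1 - |θ|² = 4 Im p / |p + i|²` for `θ = cayley p`; the factor `|p + i|² / 4` comes out of
the denominator of `mu`. -/
theorem mu_ofReal (hφ : ClassPb φ) (f : ℂ → ℂ) (x : ℝ) :
    (mu φ f x : ℂ) = (Real.pi : ℂ)⁻¹ *
      ((1 - cayley (boundaryValue φ x) * (starRingEnd ℂ) (cayley (boundaryValue φ x))) /
        ((f x * cayley (boundaryValue φ x) + reflect f x) *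
          (starRingEnd ℂ) (f x * cayley (boundaryValue φ x) + reflect f x))) := by
  have hp := hφ.closure_subset (hφ.boundaryValue_mem x)
  rw [mu, norm_sub_rev, mul_comm (boundaryValue φ x), compRe_mul_sub_compIm f hp]
  set p := boundaryValue φ x
  set D := f x * cayley p + reflect f x
  have h1 := add_I_ne_zero hp
  have h2 : (starRingEnd ℂ) p - I ≠ 0 := by
    have := (map_ne_zero (starRingEnd ℂ)).2 h1
    rwa [map_add, conj_I, ← sub_eq_add_neg] at this
  have h3 : (p.im : ℂ) = -(I / 2) * (p - (starRingEnd ℂ) p) := by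
    rw [sub_conj]
    push_cast
    linear_combination (p.im : ℂ) * I_sq
  have hpi : (Real.pi : ℂ) ≠ 0 := by exact_mod_cast Real.pi_ne_zero
  push_cast
  rw [← mul_conj', h3]
  simp only [cayley, map_div₀, map_sub, map_add, map_mul, conj_I, map_ofNat]
  rw [sub_neg_eq_add, ← sub_eq_add_neg]
  -- Nothing is assumed about `f`; if `D` vanishes, both sides are `0` by the convention for
  -- division by zero.
  by_cases hD : D = 0
  · simp [hD]
  have hD' : (starRingEnd ℂ) D ≠ 0 := (map_ne_zero _).2 hD
  field_simp
  ring

/-- With `D = Fθ + conj F`, substitute `Fθ = D - conj F`; both sides then become the same expression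
in `F`, `D` and their conjugates. -/
theorem ClassM.mu_eq_add (hf : ClassM f) (hφ : ClassPb φ) (x : ℝ) :
    (mu φ f x : ℂ) = mu (fun _ => I) f x + (2 * Real.pi * I)⁻¹ *
      (stieltjesDiff f (boundaryValue φ x) x
        - (starRingEnd ℂ) (stieltjesDiff f (boundaryValue φ x) x)) := by
  have hp := hφ.closure_subset (hφ.boundaryValue_mem x)
  have hD := hf.add_reflect_ne_zero (w := (x : ℂ)) (by simp) (norm_cayley_lt_one hp)
  rw [mu_ofReal hφ, mu_I_ofReal, stieltjesDiff]
  have hF := hf.ofReal_ne_zero x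
  rw [reflect_ofReal] at hD ⊢
  set t := cayley (boundaryValue φ x)
  set F := f x
  have hF' : (starRingEnd ℂ) F ≠ 0 := (map_ne_zero _).2 hF
  have hD' := (map_ne_zero (starRingEnd ℂ)).2 hD
  simp only [map_div₀, map_add, map_mul, map_neg, conj_I, map_ofNat, conj_conj] at hD' ⊢
  have hpi : (Real.pi : ℂ) ≠ 0 := by exact_mod_cast Real.pi_ne_zero
  have hI := I_ne_zero
  obtain ⟨D, hDe⟩ : ∃ D, D = F * t + (starRingEnd ℂ) F := ⟨_, rfl⟩
  obtain ⟨D', hDe'⟩ : ∃ D', D' = (starRingEnd ℂ) F * (starRingEnd ℂ) t + F := ⟨_, rfl⟩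
  rw [← hDe] at hD ⊢
  rw [← hDe'] at hD' ⊢
  field_simp
  rw [hDe, hDe']
  ring

/-- Trades the conjugate of the density for a pole at the conjugate point, below the line, where the
Cauchy integral vanishes. -/
theorem integral_conj_div (ρ : ℝ → ℂ) (z : ℂ) :
    ∫ x : ℝ, (starRingEnd ℂ) (ρ x) / (x - z)
      = (starRingEnd ℂ) (∫ x : ℝ, ρ x / (x - (starRingEnd ℂ) z)) := by
  rw [← integral_conj]
  simp

/-- The Stieltjes transform of `mu φ f`, compared with that of `mu I f`. -/
theorem ClassM.stieltjes_eq_add (hf : ClassM f) (hφ : ClassPb φ) {z : ℂ} (hz : 0 < z.im) :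
    Integrable (fun x : ℝ => (mu φ f x : ℂ) / ((x : ℂ) - z)) ∧
      stieltjes φ f z = stieltjes (fun _ => I) f z + stieltjesDiff f (φ z) z := by
  obtain ⟨δ, hδ, hδφ⟩ := hφ.exists_norm_cayley_le
  obtain ⟨C, hC⟩ := hf.norm_stieltjesDiff_le hδ
  have hd := hf.differentiableOn_stieltjesDiff hφ.pick
  have hb : ∀ w ∈ upperPlane, ‖stieltjesDiff f (φ w) w‖ ≤ C * (1 + ‖w‖ ^ 2)⁻¹ := fun w hw =>
    hC w _ (le_of_lt hw) (hδφ _ (subset_closure (Set.mem_image_of_mem _ hw)))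
  have hlim := hf.tendsto_stieltjesDiff hφ
  set E : ℝ → ℂ := fun x => stieltjesDiff f (boundaryValue φ x) x with hE
  have hEm : AEStronglyMeasurable E := aestronglyMeasurable_boundary hd hlim
  have hEb : ∀ x, ‖E x‖ ≤ C * (1 + x ^ 2)⁻¹ := norm_boundary_le hb hlim
  have i1 : Integrable fun x : ℝ => E x / ((x : ℂ) - z) := integrable_div_sub hEm hEb hz.ne'
  have i2 : Integrable fun x : ℝ => (starRingEnd ℂ) (E x) / ((x : ℂ) - z) :=
    integrable_div_sub (continuous_conj.comp_aestronglyMeasurable hEm)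
      (fun x => by rw [norm_conj]; exact hEb x) hz.ne'
  have i3 : Integrable fun x : ℝ => (2 * Real.pi * I)⁻¹ *
      (E x / ((x : ℂ) - z) - (starRingEnd ℂ) (E x) / ((x : ℂ) - z)) :=
    (i1.sub i2).const_mul _
  have i0 := hf.integrable_mu_div hz.ne'
  have heq : (fun x : ℝ => (mu φ f x : ℂ) / ((x : ℂ) - z)) = fun x : ℝ =>
      (mu (fun _ => I) f x : ℂ) / ((x : ℂ) - z) + (2 * Real.pi * I)⁻¹ *
        (E x / ((x : ℂ) - z) - (starRingEnd ℂ) (E x) / ((x : ℂ) - z)) := by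
    funext x
    rw [hf.mu_eq_add hφ]
    ring
  refine ⟨heq ▸ i0.add i3, ?_⟩
  rw [stieltjes, heq, integral_add i0 i3, integral_const_mul, integral_sub i1 i2,
    integral_conj_div, integral_boundary hd hb hlim hz,
    integral_boundary_of_im_neg hd hb hlim (by simpa using hz), map_zero, sub_zero, stieltjes]
  have hpi : (Real.pi : ℂ) ≠ 0 := by exact_mod_cast Real.pi_ne_zero
  have hI := I_ne_zero
  field_simp

end Parameter

end NevanlinnaType

end

/-! ### The theorem -/

open NevanlinnaType in
theorem theorem2 (f : ℂ → ℂ) (hf : ClassM f) :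
    (∀ z ∈ lowerPlane,
      Integrable (fun x : ℝ => (mu (fun _ => I) f x : ℂ) / ((x : ℂ) - z))) ∧
    ∃ g : ℂ → ℂ, Differentiable ℂ g ∧ (∀ z ∈ lowerPlane, g z = gLower f z) ∧
      ∀ a b c d : ℂ → ℂ,
        IsRealEntire a → IsRealEntire b → IsRealEntire c → IsRealEntire d →
        (∀ z : ℂ, f z = b z - I * d z) → (∀ z : ℂ, g z = a z - I * c z) →
        (∀ z : ℂ, a z * d z - b z * c z = 1) ∧
        ∀ φ : ℂ → ℂ, ClassPb φ → ∀ z ∈ upperPlane,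
          Integrable (fun x : ℝ => (mu φ f x : ℂ) / ((x : ℂ) - z)) ∧
          b z * φ z - d z ≠ 0 ∧
          stieltjes φ f z = -((a z * φ z - c z) / (b z * φ z - d z)) := by
  refine ⟨fun z hz => hf.integrable_mu_div (ne_of_lt hz), gEntire f, hf.differentiable_gEntire,
    fun z hz => hf.gEntire_eq_gLower hz, ?_⟩
  intro a b c d ha hb hc hd hfd hgd
  obtain ⟨rfl, rfl⟩ := decomposition_unique hb hd hfd
  obtain ⟨rfl, rfl⟩ := decomposition_unique ha hc hgd
  refine ⟨fun z => ?_, fun φ hφ z hz => ?_⟩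
  -- Here `f# g - f g# = 2i (ad - bc)`.
  · have h := hf.reflect_mul_gEntire_sub z
    simp only [compRe, compIm]
    linear_combination (-I / 2) * h - I_sq
  · have hz' : 0 < z.im := hz
    have hp := hφ.pick.mapsTo hz
    have h1 := add_I_ne_zero hp
    have h2 := hf.add_reflect_ne_zero hz'.le (norm_cayley_lt_one hp)
    have h3 := hf.reflect_ne_zero hz'.le
    obtain ⟨hint, heq⟩ := hf.stieltjes_eq_add hφ hz'
    -- The common factor `(φ + i) / 2` cancels in the quotient, leaving `(gθ + g#) / (fθ + f#)`.
    rw [compRe_mul_sub_compIm f hp, compRe_mul_sub_compIm (gEntire f) hp]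
    refine ⟨hint, mul_ne_zero (div_ne_zero h1 two_ne_zero) h2, ?_⟩
    rw [heq, stieltjesDiff, hf.gEntire_eq_upper hz', hf.reflect_gEntire hz']
    obtain ⟨D, hDe⟩ : ∃ D, D = f z * cayley (φ z) + reflect f z := ⟨_, rfl⟩
    rw [← hDe] at h2 ⊢
    field_simp
    rw [hDe]
    ring
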